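/- Let $q$ be a prime power. For real $x$ put $[x]_q=\frac{q^x-1}{q-1}$, and for an integer $k\ge 0$ put $\binom{x}{k}_q=\prod_{i=0}^{k-1}\frac{[x-i]_q}{[k-i]_q}$. Let $L_{n,k}$ be the set of $k$-dimensional linear subspaces of $(\mathbb F_q)^n$. For $1\le k\le n$ and $S\subseteq L_{n,k}$ the shadow of $S$ is $\partial S=\{B\in L_{n,k-1} : B\subset A \text{ for some } A\in S\}$. Let $1\le k\le n$ and $\emptyset\subsetneq S\subsetneq L_{n,k}$. Then the following three bounds hold. 1. If $|S|=\binom{x}{k}_q$ for a real number $x$ with $k\le x\le n-1$, then $|\partial S|\ge\binom{x}{k-1}_q$. 2. If $|S|=\binom{n}{k}_q\left(1+\frac{z\,(q^k-1)}{q^k(q^{n-k}-1)}\right)^{-1}$ for a real number $z$ with $1\le z\le q^n$, then $|\partial S|\ge\binom{n}{k-1}_q\left(1+\frac{z\,(q^{k-1}-1)}{q^{k-1}(q^{n-k+1}-1)}\right)^{-1}$. 3. If $|S|=\binom{n}{k}_q-\binom{y}{n-k}_q$ for a real number $y$ with $n-k+1\le y\le n-1$, then $|\partial S|\ge\binom{n}{k-1}_q-\binom{y}{n-k+1}_q$.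 (There is no such $S$ when $k=n$, so the denominators in 2 do not vanish.) -/

import Mathlib

noncomputable section

/-- The real `q`-number `[x]_q = (q ^ x - 1) / (q - 1)`. -/
def qNumber (q x : ℝ) : ℝ := (q ^ x - 1) / (q - 1)

/-- The Gaussian `q`-binomial coefficient with a real upper argument:
the product over `0 ≤ i < k` of `[x - i]_q / [k - i]_q`. -/
def qBinom (q x : ℝ) (k : ℕ) : ℝ :=
  ∏ i ∈ Finset.range k, qNumber q (x - (i : ℝ)) / qNumber q ((k : ℝ) - (i : ℝ))

/-- `L_{n,k}`: the set of `k`-dimensional linear subspaces of `F ^ n`. -/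
def subspacesOfDim (F : Type*) [Field F] (n k : ℕ) : Set (Submodule F (Fin n → F)) :=
  {A | Module.finrank F A = k}

/-- The shadow of a set `S` of `k`-dimensional subspaces (for `1 ≤ k`): all `(k - 1)`-dimensional
subspaces that are contained in some member of `S`. -/
def shadow {F : Type*} [Field F] {n : ℕ} (k : ℕ) (S : Set (Submodule F (Fin n → F))) :
    Set (Submodule F (Fin n → F)) :=
  {B | B ∈ subspacesOfDim F n (k - 1) ∧ ∃ A ∈ S, B < A}

end

/-!
The first and the third bound are two readings of one clique estimate, `card_le_qBinom_succ`:
if a family `G` of `k`-dimensional subspaces has `qBinom q x k` members, then at most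
`qBinom q x (k + 1)` subspaces of dimension `k + 1` have all their hyperplanes in `G`. It is proved
by induction on `k`, following Keevash. For a point `P` let `G(P)` and `K(P)` be the members through
`P` of `G` and of the family `K` of cliques. Both when `G(P)` is small, by induction, and when it is
large, because each member of `K(P)` uses up `q ^ k` members of `G` avoiding `P`, one gets
`|K(P)| ≤ [x - k] / [k] * |G(P)|`, and summing over `P` gives the claim.

* For the first bound, the members of `S` are cliques over the shadow
  (`qBinom_le_card_of_shadow_subset`).
* For the third bound, let `T` be the family of `(k - 1)`-dimensional subspaces outside the shadow.
  In the dual space the annihilators of its members are cliques over the annihilators of the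
  `k`-dimensional subspaces outside `S` (`card_le_qBinom_of_no_incidence`).

The second bound is spectral. It says that the odds `|∂S| / |T|` are at least a fixed multiple of
the odds of `S` among all `k`-dimensional subspaces. As there are no incidences between `S` and `T`,
this is Haemers' bound for cross-independent pairs (`card_mul_card_le_of_no_incidence`), the
constant being the ratio of the two largest squared singular values of the inclusion matrix.
The second one is bounded in `sum_sumAbove_sq_le`, by induction on the dimension through the
commutation relation of the up and down operators.
-/

/-! ### Gaussian binomial coefficients with a real upper argument -/

lemma qNumber_strictMono {q : ℝ} (hq : 1 < q) : StrictMono (qNumber q) := by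
  intro x y hxy
  unfold qNumber
  have := Real.rpow_lt_rpow_of_exponent_lt hq hxy
  have h1 : 0 < q - 1 := by linarith
  gcongr

lemma qNumber_zero (q : ℝ) : qNumber q 0 = 0 := by simp [qNumber]

lemma qNumber_one {q : ℝ} (hq : 1 < q) : qNumber q 1 = 1 := by
  have h1 : q - 1 ≠ 0 := by linarith
  simp [qNumber, h1]

lemma qNumber_natCast (q : ℝ) (m : ℕ) : qNumber q m = (q ^ m - 1) / (q - 1) := by
  simp [qNumber]

lemma qNumber_natCast_eq_geom {q : ℝ} (hq : 1 < q) (m : ℕ) :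
    qNumber q m = ∑ i ∈ Finset.range m, q ^ i := by
  rw [qNumber_natCast, geom_sum_eq hq.ne']

lemma qNumber_pos {q x : ℝ} (hq : 1 < q) (hx : 0 < x) : 0 < qNumber q x := by
  rw [← qNumber_zero q]; exact qNumber_strictMono hq hx

lemma qNumber_nonneg {q x : ℝ} (hq : 1 < q) (hx : 0 ≤ x) : 0 ≤ qNumber q x := by
  rw [← qNumber_zero q]; exact (qNumber_strictMono hq).monotone hx

lemma qNumber_add_natCast {q : ℝ} (hq : 1 < q) (x : ℝ) (m : ℕ) :
    qNumber q (m + x) = qNumber q m + q ^ m * qNumber q x := by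
  have h1 : q - 1 ≠ 0 := by linarith
  have h0 : 0 < q := by linarith
  simp only [qNumber, Real.rpow_add h0, Real.rpow_natCast]
  field_simp
  ring

lemma qNumber_add_one {q : ℝ} (hq : 1 < q) (x : ℝ) : qNumber q (x + 1) = 1 + q * qNumber q x := by
  have := qNumber_add_natCast hq x 1
  rw [Nat.cast_one, qNumber_one hq, pow_one] at this
  rw [add_comm, this]

lemma continuous_qNumber {q : ℝ} (hq : 1 < q) : Continuous (qNumber q) := by
  unfold qNumber
  have : Continuous fun x : ℝ => q ^ x := Real.continuous_const_rpow (by positivity)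
  fun_prop

lemma qBinom_eq_div (q x : ℝ) (k : ℕ) :
    qBinom q x k = (∏ i ∈ Finset.range k, qNumber q (x - i)) /
      ∏ i ∈ Finset.range k, qNumber q ((i + 1 : ℕ) : ℝ) := by
  unfold qBinom
  rw [Finset.prod_div_distrib]
  congr 1
  rw [← Finset.prod_range_reflect]
  refine Finset.prod_congr rfl fun i hi => ?_
  have := Finset.mem_range.1 hi
  congr 1
  rw [eq_comm, ← Nat.cast_sub (by omega)]
  congr 1
  omega

lemma qBinom_zero_right (q x : ℝ) : qBinom q x 0 = 1 := by simp [qBinom]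

lemma qBinom_succ (q x : ℝ) (k : ℕ) :
    qBinom q x (k + 1) = qBinom q x k * (qNumber q (x - k) / qNumber q ((k + 1 : ℕ) : ℝ)) := by
  rw [qBinom_eq_div, qBinom_eq_div, Finset.prod_range_succ, Finset.prod_range_succ,
    mul_div_mul_comm]

lemma qBinom_succ' (q x : ℝ) (k : ℕ) :
    qBinom q x (k + 1) = qNumber q x / qNumber q ((k + 1 : ℕ) : ℝ) * qBinom q (x - 1) k := by
  rw [qBinom_eq_div, qBinom_eq_div, Finset.prod_range_succ', Finset.prod_range_succ,
    Nat.cast_zero, sub_zero, mul_comm (∏ _ ∈ _, _), mul_comm (∏ _ ∈ _, _), mul_div_mul_comm]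
  congr 2
  refine Finset.prod_congr rfl fun i _ => ?_
  congr 1
  push_cast
  ring

/-- The `q`-Pascal rule. -/
lemma qBinom_pascal {q : ℝ} (hq : 1 < q) (x : ℝ) (k : ℕ) :
    qBinom q x (k + 1) = qBinom q (x - 1) k + q ^ (k + 1) * qBinom q (x - 1) (k + 1) := by
  have h : 0 < qNumber q ((k + 1 : ℕ) : ℝ) := qNumber_pos hq (by positivity)
  have hx : qNumber q x = qNumber q ((k + 1 : ℕ) : ℝ) + q ^ (k + 1) * qNumber q (x - 1 - k) := by
    rw [← qNumber_add_natCast hq]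
    congr 1
    push_cast
    ring
  rw [qBinom_succ', qBinom_succ q (x - 1), hx]
  field_simp

lemma qBinom_nonneg {q x : ℝ} (hq : 1 < q) {k : ℕ} (hx : (k : ℝ) - 1 ≤ x) : 0 ≤ qBinom q x k := by
  rw [qBinom_eq_div]
  refine div_nonneg (Finset.prod_nonneg fun i hi => qNumber_nonneg hq ?_)
    (Finset.prod_nonneg fun i hi => qNumber_nonneg hq (by positivity))
  have : ((i + 1 : ℕ) : ℝ) ≤ k := by exact_mod_cast Finset.mem_range.1 hi
  push_cast at this
  linarith

lemma qBinom_strictMono {q x y : ℝ} (hq : 1 < q) (k : ℕ) (hx : (k : ℝ) ≤ x) (hxy : x < y) :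
    qBinom q x (k + 1) < qBinom q y (k + 1) := by
  induction k generalizing x y with
  | zero =>
    rw [qBinom_succ', qBinom_succ', qBinom_zero_right, qBinom_zero_right]
    have := qNumber_strictMono hq hxy
    have h : 0 < qNumber q ((0 + 1 : ℕ) : ℝ) := qNumber_pos hq (by positivity)
    gcongr
  | succ k ih =>
    push_cast at hx
    rw [qBinom_succ', qBinom_succ' q y]
    have h1 := qNumber_strictMono hq hxy
    have h : 0 < qNumber q ((k + 1 + 1 : ℕ) : ℝ) := qNumber_pos hq (by positivity)
    have h2 := ih (x := x - 1) (y := y - 1) (by linarith) (by linarith)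
    have h3 : 0 ≤ qNumber q x := qNumber_nonneg hq (by linarith [(Nat.cast_nonneg k : (0 : ℝ) ≤ k)])
    refine mul_lt_mul'' ?_ h2 (by positivity) (qBinom_nonneg hq (by push_cast; linarith))
    gcongr

lemma qBinom_self {q : ℝ} (hq : 1 < q) (k : ℕ) : qBinom q k k = 1 := by
  induction k with
  | zero => exact qBinom_zero_right _ _
  | succ k ih =>
    rw [qBinom_succ', show ((k + 1 : ℕ) : ℝ) - 1 = k by push_cast; ring, ih, mul_one]
    exact div_self (qNumber_pos hq (by positivity)).ne'

lemma continuous_qBinom {q : ℝ} (hq : 1 < q) (k : ℕ) : Continuous fun x => qBinom q x k := by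
  unfold qBinom
  have := continuous_qNumber hq
  fun_prop

lemma qNumber_le_qBinom_succ {q x : ℝ} (hq : 1 < q) (k : ℕ) (hx : (k : ℝ) + 1 ≤ x) :
    qNumber q x / qNumber q ((k + 1 : ℕ) : ℝ) ≤ qBinom q x (k + 1) := by
  have h : 0 < qNumber q ((k + 1 : ℕ) : ℝ) := qNumber_pos hq (by positivity)
  have h3 : 0 ≤ qNumber q x := qNumber_nonneg hq (by linarith [(Nat.cast_nonneg k : (0 : ℝ) ≤ k)])
  rw [qBinom_succ']
  refine le_mul_of_one_le_right (by positivity) ?_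
  refine (qBinom_self hq k).symm.trans_le ?_
  rcases k with _ | k
  · rw [qBinom_zero_right, qBinom_zero_right]
  rcases (show ((k + 1 : ℕ) : ℝ) ≤ x - 1 by linarith).eq_or_lt with h | h
  · rw [h]
  · exact (qBinom_strictMono hq k (by push_cast; linarith) h).le

lemma exists_qBinom_eq {q : ℝ} (hq : 1 < q) (k : ℕ) {c : ℝ} (hc : 1 ≤ c) :
    ∃ x : ℝ, ((k + 1 : ℕ) : ℝ) ≤ x ∧ qBinom q x (k + 1) = c := by
  have hpos : 0 < qNumber q ((k + 1 : ℕ) : ℝ) := qNumber_pos hq (by positivity)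
  -- some integer `N > k` is large enough for the value at `N` to exceed `c`
  obtain ⟨N, hN⟩ : ∃ N : ℕ, c ≤ qBinom q (N : ℝ) (k + 1) ∧ k + 1 ≤ N := by
    obtain ⟨m, hm⟩ := exists_nat_gt (c * qNumber q ((k + 1 : ℕ) : ℝ))
    refine ⟨m + (k + 1), le_trans ?_ (qNumber_le_qBinom_succ hq k (by push_cast; linarith
      [(Nat.cast_nonneg m : (0:ℝ) ≤ m)])), by omega⟩
    rw [le_div_iff₀ hpos]
    refine hm.le.trans ?_
    rw [qNumber_natCast_eq_geom hq]
    calc (m : ℝ) ≤ ((m + (k + 1) : ℕ) : ℝ) := by exact_mod_cast Nat.le_add_right _ _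
      _ = ∑ i ∈ Finset.range (m + (k + 1)), (1 : ℝ) := by simp
      _ ≤ _ := Finset.sum_le_sum fun i _ => one_le_pow₀ hq.le
  have hle : ((k + 1 : ℕ) : ℝ) ≤ N := by exact_mod_cast hN.2
  obtain ⟨x, hx, hxc⟩ := intermediate_value_Icc hle (continuous_qBinom hq (k + 1)).continuousOn
    ⟨(qBinom_self hq (k + 1)).trans_le hc, hN.1⟩
  exact ⟨x, hx.1, hxc⟩

/-! ### Counting subspaces in an interval -/

section Counting

open Module

variable {F : Type*} [Field F] {V : Type*} [AddCommGroup V] [Module F V]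

lemma finrank_comap_mkQ [FiniteDimensional F V] (W : Submodule F V) (L : Submodule F (V ⧸ W)) :
    finrank F (L.comap W.mkQ) = finrank F W + finrank F L := by
  have h := LinearMap.finrank_range_add_finrank_ker (W.mkQ.domRestrict (L.comap W.mkQ))
  have h1 : LinearMap.range (W.mkQ.domRestrict (L.comap W.mkQ)) = L := by
    rw [LinearMap.range_domRestrict, Submodule.map_comap_eq_of_surjective W.mkQ_surjective]
  have h2 : LinearMap.ker (W.mkQ.domRestrict (L.comap W.mkQ)) = W.submoduleOf (L.comap W.mkQ) := by
    ext x
    simp [Submodule.submoduleOf]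
  rw [h1, h2, (Submodule.submoduleOfEquivOfLe (Submodule.le_comap_mkQ W L)).finrank_eq] at h
  omega

variable [Finite F]

lemma natCard_finrank_eq_one :
    Nat.card {P : Submodule F V // finrank F P = 1} =
      ∑ i ∈ Finset.range (finrank F V), Nat.card F ^ i := by
  rw [← Projectivization.card_of_finrank F V rfl]
  exact (Nat.card_congr (Projectivization.equivSubmodule F V)).symm

variable [FiniteDimensional F V]

lemma natCard_covers (W : Submodule F V) :
    Nat.card {P : Submodule F V // W ≤ P ∧ finrank F P = finrank F W + 1} =
      ∑ i ∈ Finset.range (finrank F V - finrank F W), Nat.card F ^ i := by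
  rw [← Submodule.finrank_quotient, ← natCard_finrank_eq_one]
  refine Nat.card_congr ?_
  refine (Equiv.subtypeSubtypeEquivSubtypeInter (fun P => W ≤ P) _).symm.trans ?_
  refine (Equiv.subtypeEquiv (Submodule.comapMkQRelIso W).toEquiv fun L => ?_).symm
  have : finrank F ((Submodule.comapMkQRelIso W).toEquiv L : Submodule F V) =
    finrank F W + finrank F L := finrank_comap_mkQ W L
  rw [this]
  omega

/-- The number of `(dim W + 1)`-dimensional subspaces between `W` and `C`. -/
lemma natCard_covers_le {W C : Submodule F V} (hWC : W ≤ C) :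
    Nat.card {P : Submodule F V // W ≤ P ∧ P ≤ C ∧ finrank F P = finrank F W + 1} =
      ∑ i ∈ Finset.range (finrank F C - finrank F W), Nat.card F ^ i := by
  have h := natCard_covers (W.submoduleOf C)
  have hW : finrank F (W.submoduleOf C) = finrank F W :=
    (Submodule.submoduleOfEquivOfLe hWC).finrank_eq
  rw [hW] at h
  rw [← h]
  refine Nat.card_congr ?_
  refine Equiv.trans (Equiv.subtypeEquivRight fun P => by
    rw [and_left_comm]) ((Equiv.subtypeSubtypeEquivSubtypeInter (fun P => P ≤ C) _).symm.trans ?_)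
  refine (Equiv.subtypeEquiv (Submodule.MapSubtype.orderIso C).toEquiv fun L => ?_).symm
  change _ ↔ W ≤ L.map C.subtype ∧ finrank F (L.map C.subtype) = _
  rw [Submodule.finrank_map_subtype_eq]
  refine and_congr_left fun _ => ?_
  constructor
  · intro hL w hw
    exact ⟨⟨w, hWC hw⟩, hL hw, rfl⟩
  · rintro hL ⟨w, hwC⟩ hw
    obtain ⟨x, hx, hxw⟩ := hL hw
    rwa [show (⟨w, hwC⟩ : C) = x from Subtype.ext hxw.symm]

/-- The number of subspaces of codimension one in `C` that contain `W`; by duality, it is the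
number of points of the corresponding interval in the dual space. -/
lemma natCard_coatoms {W C : Submodule F V} (hWC : W ≤ C) :
    Nat.card {H : Submodule F V // W ≤ H ∧ H ≤ C ∧ finrank F H + 1 = finrank F C} =
      ∑ i ∈ Finset.range (finrank F C - finrank F W), Nat.card F ^ i := by
  have hd : C.dualAnnihilator ≤ W.dualAnnihilator := Submodule.dualAnnihilator_anti hWC
  have h := natCard_covers_le hd
  have e1 := Subspace.finrank_add_finrank_dualAnnihilator_eq C
  have e2 := Subspace.finrank_add_finrank_dualAnnihilator_eq W
  have e3 := Submodule.finrank_mono hWC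
  rw [show finrank F W.dualAnnihilator - finrank F C.dualAnnihilator =
    finrank F C - finrank F W by omega] at h
  rw [← h]
  refine Nat.card_congr (Equiv.subtypeEquiv
    ((Subspace.orderIsoFiniteDimensional (K := F) (V := V)).toEquiv.trans OrderDual.ofDual)
    fun H => ?_)
  change _ ↔ C.dualAnnihilator ≤ H.dualAnnihilator ∧ H.dualAnnihilator ≤ W.dualAnnihilator ∧ _
  rw [Subspace.dualAnnihilator_le_dualAnnihilator_iff,
    Subspace.dualAnnihilator_le_dualAnnihilator_iff]
  change _ ↔ _ ∧ _ ∧ finrank F H.dualAnnihilator = _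
  have e4 := Subspace.finrank_add_finrank_dualAnnihilator_eq H
  constructor
  · rintro ⟨a, b, c⟩
    exact ⟨b, a, by omega⟩
  · rintro ⟨a, b, c⟩
    exact ⟨b, a, by omega⟩

end Counting

/-! ### The number of cliques of a family of subspaces -/

section Cliques

open Module

variable {F : Type*} [Field F] {V : Type*} [AddCommGroup V] [Module F V]
  [FiniteDimensional F V]

lemma sup_eq_of_not_le {P A C : Submodule F V} (hPC : P ≤ C) (hAC : A ≤ C) (hPA : ¬ P ≤ A)
    (hd : finrank F C = finrank F A + 1) : A ⊔ P = C := by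
  refine Submodule.eq_of_le_of_finrank_le (sup_le hAC hPC) ?_
  have : finrank F A < finrank F (A ⊔ P : Submodule F V) :=
    Submodule.finrank_lt_finrank_of_lt (left_lt_sup.2 hPA)
  omega

variable [Finite F]

lemma finite_submodule_of_finite : Finite (Submodule F V) :=
  have : Finite V := Module.finite_of_finite F
  inferInstance

open scoped Classical in
/-- Every `C` in `K` through the point `P` contributes `q ^ j` members of `G` that avoid `P`,
and each such member `A` determines `C = A ⊔ P`. -/
lemma pow_mul_card_filter_le {j : ℕ} {W P : Submodule F V} (hWP : W ≤ P)
    (hP : finrank F P = finrank F W + 1) {G K : Finset (Submodule F V)}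
    (hK : ∀ C ∈ K, finrank F C = finrank F W + (j + 1) ∧
      ∀ A, W ≤ A → A ≤ C → finrank F A = finrank F W + j → A ∈ G) :
    Nat.card F ^ j * (K.filter (P ≤ ·)).card + (G.filter (P ≤ ·)).card ≤ G.card := by
  have := finite_submodule_of_finite (F := F) (V := V)
  have := Fintype.ofFinite (Submodule F V)
  rw [← Finset.card_filter_add_card_filter_not (s := G) (P ≤ ·), add_comm]
  gcongr
  set T : Submodule F V → Finset (Submodule F V) := fun C =>
    Finset.univ.filter fun A => (W ≤ A ∧ A ≤ C ∧ finrank F A + 1 = finrank F C) ∧ ¬ P ≤ A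
  have hT : ∀ C ∈ K.filter (P ≤ ·), (T C).card = Nat.card F ^ j := by
    intro C hC
    obtain ⟨hC, hPC⟩ := Finset.mem_filter.1 hC
    obtain ⟨hCd, -⟩ := hK C hC
    have h1 := natCard_coatoms (hWP.trans hPC)
    have h2 := natCard_coatoms hPC
    rw [Nat.subtype_card (Finset.univ.filter fun A =>
      W ≤ A ∧ A ≤ C ∧ finrank F A + 1 = finrank F C) (by simp),
      ← Finset.card_filter_add_card_filter_not (P ≤ ·), Finset.filter_filter,
      Finset.filter_filter, show finrank F C - finrank F W = j + 1 by omega,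
      Finset.sum_range_succ] at h1
    rw [Nat.subtype_card (Finset.univ.filter fun A =>
      (W ≤ A ∧ A ≤ C ∧ finrank F A + 1 = finrank F C) ∧ P ≤ A) (by
        intro A
        simp only [Finset.mem_filter, Finset.mem_univ, true_and]
        exact ⟨fun h => ⟨h.2, h.1.2⟩, fun h => ⟨⟨hWP.trans h.1, h.2⟩, h.1⟩⟩),
      show finrank F C - finrank F P = j by omega] at h2
    refine Nat.add_left_cancel (n := ∑ i ∈ Finset.range j, Nat.card F ^ i) (Eq.trans ?_ h1)
    rw [← h2]
  rw [mul_comm, ← smul_eq_mul, ← Finset.sum_const, ← Finset.sum_congr rfl hT,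
    ← Finset.card_biUnion]
  · refine Finset.card_le_card fun A hA => ?_
    obtain ⟨C, hC, hA⟩ := Finset.mem_biUnion.1 hA
    obtain ⟨hC, hPC⟩ := Finset.mem_filter.1 hC
    obtain ⟨hCd, hCG⟩ := hK C hC
    obtain ⟨⟨h1, h2, h3⟩, h4⟩ := (Finset.mem_filter.1 hA).2
    exact Finset.mem_filter.2 ⟨hCG A h1 h2 (by omega), h4⟩
  · intro C hC C' hC' hne
    refine Finset.disjoint_left.2 fun A hA hA' => hne ?_
    obtain ⟨⟨h1, h2, h3⟩, h4⟩ := (Finset.mem_filter.1 hA).2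
    obtain ⟨⟨h1', h2', h3'⟩, -⟩ := (Finset.mem_filter.1 hA').2
    rw [← sup_eq_of_not_le (Finset.mem_filter.1 hC).2 h2 h4 h3.symm,
      ← sup_eq_of_not_le (Finset.mem_filter.1 hC').2 h2' h4 h3'.symm]

open scoped Classical in
lemma sum_card_filter_points [Fintype (Submodule F V)] {j : ℕ} {W : Submodule F V}
    {G : Finset (Submodule F V)}
    (hG : ∀ A ∈ G, W ≤ A ∧ finrank F A = finrank F W + j) :
    ∑ P with W ≤ P ∧ finrank F P = finrank F W + 1, (G.filter (P ≤ ·)).card =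
      G.card * ∑ i ∈ Finset.range j, Nat.card F ^ i := by
  have h := Finset.sum_card_bipartiteAbove_eq_sum_card_bipartiteBelow
    (s := Finset.univ.filter fun P : Submodule F V => W ≤ P ∧ finrank F P = finrank F W + 1)
    (t := G) (· ≤ ·)
  refine h.trans ?_
  rw [← smul_eq_mul, ← Finset.sum_const]
  refine Finset.sum_congr rfl fun A hA => ?_
  have h1 := natCard_covers_le (hG A hA).1
  rw [(hG A hA).2, Nat.add_sub_cancel_left] at h1
  rw [← h1, eq_comm]
  refine Nat.subtype_card _ fun P => ?_
  simp only [Finset.bipartiteBelow, Finset.mem_filter, Finset.mem_univ, true_and]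
  tauto

/-- Let `G` be a family of `dim W + k` dimensional subspaces containing `W`, where `k = j + 1`,
and let `K` consist of subspaces of one dimension more all of whose `dim W + k` dimensional
subspaces containing `W` belong to `G`. If `|G| = qBinom q x k` with `k ≤ x`,
then `|K| ≤ qBinom q x (k + 1)`.

The base `W` is carried along so that the links of points `P` above `W`, which are the families of
members containing `P`, are again of the same form and induction applies to them. -/
theorem card_le_qBinom_succ (j : ℕ) (W : Submodule F V) (G K : Finset (Submodule F V))
    (hG : ∀ A ∈ G, W ≤ A ∧ finrank F A = finrank F W + (j + 1))
    (hK : ∀ C ∈ K, W ≤ C ∧ finrank F C = finrank F W + (j + 2) ∧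
      ∀ A, W ≤ A → A ≤ C → finrank F A = finrank F W + (j + 1) → A ∈ G)
    {x : ℝ} (hx : (j : ℝ) + 1 ≤ x) (hc : (G.card : ℝ) = qBinom (Nat.card F) x (j + 1)) :
    (K.card : ℝ) ≤ qBinom (Nat.card F) x (j + 2) := by
  classical
  have hq : (1 : ℝ) < Nat.card F := by exact_mod_cast Finite.one_lt_card
  have := finite_submodule_of_finite (F := F) (V := V)
  have := Fintype.ofFinite (Submodule F V)
  induction j using Nat.strong_induction_on generalizing W G K x with | _ j ih
  -- it suffices to bound the link of each point
  suffices key : ∀ P : Submodule F V, W ≤ P → finrank F P = finrank F W + 1 →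
      ((K.filter (P ≤ ·)).card : ℝ) ≤
        qNumber (Nat.card F) (x - (j + 1)) / qNumber (Nat.card F) ((j + 1 : ℕ) : ℝ) *
          (G.filter (P ≤ ·)).card by
    have h1 := sum_card_filter_points hG
    have h2 := sum_card_filter_points fun C hC => ⟨(hK C hC).1, (hK C hC).2.1⟩
    have h3 := Finset.sum_le_sum fun P (hP : P ∈ Finset.univ.filter fun P : Submodule F V =>
      W ≤ P ∧ finrank F P = finrank F W + 1) =>
        key P (Finset.mem_filter.1 hP).2.1 (Finset.mem_filter.1 hP).2.2
    rw [← Finset.mul_sum, ← Nat.cast_sum, ← Nat.cast_sum, h1, h2] at h3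
    push_cast at h3
    rw [← qNumber_natCast_eq_geom hq, ← qNumber_natCast_eq_geom hq, hc] at h3
    have p1 : 0 < qNumber (Nat.card F) ((j + 1 : ℕ) : ℝ) := qNumber_pos hq (by positivity)
    have p2 : 0 < qNumber (Nat.card F) ((j + 2 : ℕ) : ℝ) := qNumber_pos hq (by positivity)
    rw [qBinom_succ, mul_div_assoc', le_div_iff₀ p2]
    refine h3.trans_eq ?_
    push_cast
    push_cast at p1
    field_simp
  intro P hWP hP
  have p1 : 0 < qNumber (Nat.card F) ((j + 1 : ℕ) : ℝ) := qNumber_pos hq (by positivity)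
  have p2 : 0 ≤ qNumber (Nat.card F) (x - (j + 1)) := qNumber_nonneg hq (by linarith)
  have hqj : (0 : ℝ) < (Nat.card F : ℝ) ^ (j + 1) := by positivity
  rcases le_or_gt (qBinom (Nat.card F) (x - 1) j) ((G.filter (P ≤ ·)).card : ℝ) with hbig | hsmall
  · -- a large link leaves few members of `G` avoiding `P`
    have h := pow_mul_card_filter_le (j := j + 1) hWP hP (G := G) (K := K)
      fun C hC => ⟨(hK C hC).2.1, (hK C hC).2.2⟩
    have h' : (Nat.card F : ℝ) ^ (j + 1) * (K.filter (P ≤ ·)).card + (G.filter (P ≤ ·)).card ≤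
      G.card := by exact_mod_cast h
    rw [hc, qBinom_pascal hq] at h'
    have h2 : ((K.filter (P ≤ ·)).card : ℝ) ≤ qBinom (Nat.card F) (x - 1) (j + 1) := by
      refine le_of_mul_le_mul_left ?_ hqj
      linarith
    refine h2.trans ?_
    rw [qBinom_succ, mul_comm, show x - 1 - j = x - (j + 1) by ring]
    gcongr
  · -- a small link is handled by induction
    rcases Finset.eq_empty_or_nonempty (G.filter (P ≤ ·)) with h0 | hne
    · have : K.filter (P ≤ ·) = ∅ := by
        refine Finset.filter_eq_empty_iff.2 fun C hC hPC => ?_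
        have hCd := (hK C hC).2.1
        have h1 := natCard_coatoms hPC
        rw [show finrank F C - finrank F P = j + 1 by omega, Finset.sum_range_succ] at h1
        have h2 : 0 < Nat.card F ^ j := pow_pos Nat.card_pos j
        obtain ⟨⟨A, hPA, hAC, hA⟩⟩ := (Nat.card_pos_iff.1 (h1 ▸ Nat.add_pos_right _ h2)).1
        exact Finset.filter_eq_empty_iff.1 h0
          ((hK C hC).2.2 A (hWP.trans hPA) hAC (by omega)) hPA
      rw [this, h0]
      simp
    · have h1 : (1 : ℝ) ≤ (G.filter (P ≤ ·)).card := by exact_mod_cast hne.card_pos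
      rcases j with _ | j
      · rw [qBinom_zero_right] at hsmall
        linarith
      obtain ⟨y, hy, hyc⟩ := exists_qBinom_eq hq j h1
      push_cast at hx hy
      have hyx : y ≤ x - 1 := by
        by_contra! hlt
        have := qBinom_strictMono hq j (by linarith) hlt
        linarith
      have h2 := ih j j.lt_succ_self P (G.filter (P ≤ ·)) (K.filter (P ≤ ·))
        (fun A hA => ⟨(Finset.mem_filter.1 hA).2, by
          rw [(hG A (Finset.mem_filter.1 hA).1).2]; omega⟩)
        (fun C hC => ⟨(Finset.mem_filter.1 hC).2, by
          rw [(hK C (Finset.mem_filter.1 hC).1).2.1]; omega, fun A hPA hAC hA =>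
            Finset.mem_filter.2 ⟨(hK C (Finset.mem_filter.1 hC).1).2.2 A (hWP.trans hPA) hAC
              (by omega), hPA⟩⟩) hy hyc.symm
      refine h2.trans ?_
      rw [qBinom_succ, hyc, mul_comm]
      gcongr
      refine (qNumber_strictMono hq).monotone ?_
      push_cast
      linarith

end Cliques

/-! ### The spectral gap of the inclusion matrices -/

section Spectral

open Module

variable {F : Type*} [Field F] {V : Type*} [AddCommGroup V] [Module F V]
  [Fintype (Submodule F V)]

open scoped Classical in
/-- The `k`-dimensional subspaces of `V`. -/
noncomputable def grassmannian (F V : Type*) [Field F] [AddCommGroup V] [Module F V]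
    [Fintype (Submodule F V)] (k : ℕ) : Finset (Submodule F V) :=
  Finset.univ.filter fun A => finrank F A = k

lemma mem_grassmannian {k : ℕ} {A : Submodule F V} : A ∈ grassmannian F V k ↔ finrank F A = k := by
  simp [grassmannian]

open scoped Classical in
/-- The down operator: it sums a function on `k`-dimensional subspaces
over all those that contain a given subspace. -/
noncomputable def sumAbove (k : ℕ) (f : Submodule F V → ℝ) (B : Submodule F V) : ℝ :=
  ∑ A ∈ grassmannian F V k with B ≤ A, f A

open scoped Classical in
/-- The up operator: it sums a function on `k`-dimensional subspaces
over all those contained in a given subspace. -/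
noncomputable def sumBelow (k : ℕ) (g : Submodule F V → ℝ) (A : Submodule F V) : ℝ :=
  ∑ B ∈ grassmannian F V k with B ≤ A, g B

/-- The up and down operators are adjoint to each other. -/
lemma sum_mul_sumAbove (k l : ℕ) (f g : Submodule F V → ℝ) :
    ∑ B ∈ grassmannian F V k, g B * sumAbove l f B =
      ∑ A ∈ grassmannian F V l, sumBelow k g A * f A := by
  simp only [sumAbove, sumBelow, Finset.mul_sum, Finset.sum_mul, Finset.sum_filter]
  rw [Finset.sum_comm]
  refine Finset.sum_congr rfl fun A _ => Finset.sum_congr rfl fun B _ => ?_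
  split_ifs <;> simp

variable [FiniteDimensional F V]

open scoped Classical in
/-- Two different subspaces of dimension `k + 1` have as many common covers as common coatoms:
one of each if they meet in dimension `k`, and none otherwise. -/
lemma card_common_covers_eq {k : ℕ} {B B' : Submodule F V} (hB : finrank F B = k + 1)
    (hB' : finrank F B' = k + 1) (hne : B' ≠ B) :
    ((grassmannian F V (k + 2)).filter fun A => B ≤ A ∧ B' ≤ A).card =
      ((grassmannian F V k).filter fun C => C ≤ B ∧ C ≤ B').card := by
  have hadd := Submodule.finrank_sup_add_finrank_inf_eq B B'
  have hlt : finrank F B < finrank F (B ⊔ B' : Submodule F V) := by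
    refine Submodule.finrank_lt_finrank_of_lt (left_lt_sup.2 fun h => hne ?_)
    exact Submodule.eq_of_le_of_finrank_eq h (by omega)
  by_cases hd : finrank F (B ⊔ B' : Submodule F V) = k + 2
  · rw [show (grassmannian F V (k + 2)).filter (fun A => B ≤ A ∧ B' ≤ A) = {B ⊔ B'} from ?_,
      show (grassmannian F V k).filter (fun C => C ≤ B ∧ C ≤ B') = {B ⊓ B'} from ?_,
      Finset.card_singleton, Finset.card_singleton]
    · ext C
      rw [Finset.mem_filter, mem_grassmannian, Finset.mem_singleton]
      constructor
      · rintro ⟨h1, h2, h3⟩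
        exact Submodule.eq_of_le_of_finrank_eq (le_inf h2 h3) (by omega)
      · rintro rfl
        exact ⟨by omega, inf_le_left, inf_le_right⟩
    · ext A
      rw [Finset.mem_filter, mem_grassmannian, Finset.mem_singleton]
      constructor
      · rintro ⟨h1, h2, h3⟩
        exact (Submodule.eq_of_le_of_finrank_eq (sup_le h2 h3) (by omega)).symm
      · rintro rfl
        exact ⟨hd, le_sup_left, le_sup_right⟩
  · rw [Finset.filter_eq_empty_iff.2, Finset.filter_eq_empty_iff.2]
    · rintro C hC ⟨h1, h2⟩
      have := Submodule.finrank_mono (le_inf h1 h2)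
      rw [mem_grassmannian] at hC
      omega
    · rintro A hA ⟨h1, h2⟩
      have := Submodule.finrank_mono (sup_le h1 h2)
      rw [mem_grassmannian] at hA
      omega

variable [Finite F]

open scoped Classical in
lemma card_filter_above {k : ℕ} {B : Submodule F V} (hB : finrank F B = k) :
    (((grassmannian F V (k + 1)).filter (B ≤ ·)).card : ℝ) =
      qNumber (Nat.card F) ((finrank F V - k : ℕ) : ℝ) := by
  rw [qNumber_natCast_eq_geom (by exact_mod_cast Finite.one_lt_card)]
  have h := natCard_covers B
  rw [hB] at h
  rw [← Nat.subtype_card _ (p := fun P => B ≤ P ∧ finrank F P = k + 1), h]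
  · push_cast
    rfl
  · intro A
    rw [Finset.mem_filter, mem_grassmannian, and_comm]

open scoped Classical in
lemma card_filter_below {k : ℕ} {A : Submodule F V} (hA : finrank F A = k + 1) :
    (((grassmannian F V k).filter (· ≤ A)).card : ℝ) =
      qNumber (Nat.card F) ((k + 1 : ℕ) : ℝ) := by
  rw [qNumber_natCast_eq_geom (by exact_mod_cast Finite.one_lt_card)]
  have h := natCard_coatoms (bot_le : ⊥ ≤ A)
  rw [hA, finrank_bot, Nat.sub_zero] at h
  rw [← Nat.subtype_card _ (p := fun P => ⊥ ≤ P ∧ P ≤ A ∧ finrank F P + 1 = k + 1), h]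
  · push_cast
    rfl
  · intro A
    rw [Finset.mem_filter, mem_grassmannian]
    simp only [bot_le, true_and, Nat.add_right_cancel_iff]
    exact and_comm

lemma sum_sumAbove (k : ℕ) (f : Submodule F V → ℝ) :
    ∑ B ∈ grassmannian F V k, sumAbove (k + 1) f B =
      qNumber (Nat.card F) ((k + 1 : ℕ) : ℝ) * ∑ A ∈ grassmannian F V (k + 1), f A := by
  have h := sum_mul_sumAbove k (k + 1) f 1
  simp only [Pi.one_apply, one_mul] at h
  rw [h, Finset.mul_sum]
  refine Finset.sum_congr rfl fun A hA => ?_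
  rw [← card_filter_below (mem_grassmannian.1 hA)]
  simp [sumBelow]

/-- The commutation relation `D U = U D + ([n - k - 1] - [k + 1]) I` of the down operator `D` and
the up operator `U` on functions on `(k + 1)`-dimensional subspaces. -/
lemma sumAbove_sumBelow {k : ℕ} (g : Submodule F V → ℝ) {B : Submodule F V}
    (hB : finrank F B = k + 1) :
    sumAbove (k + 2) (sumBelow (k + 1) g) B = sumBelow k (sumAbove (k + 1) g) B +
      (qNumber (Nat.card F) ((finrank F V - (k + 1) : ℕ) : ℝ) -
        qNumber (Nat.card F) ((k + 1 : ℕ) : ℝ)) * g B := by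
  classical
  have h1 : sumAbove (k + 2) (sumBelow (k + 1) g) B = ∑ B' ∈ grassmannian F V (k + 1),
      (((grassmannian F V (k + 2)).filter fun A => B ≤ A ∧ B' ≤ A).card : ℝ) * g B' := by
    simp only [sumAbove, sumBelow, Finset.sum_filter, Finset.card_filter, Nat.cast_sum,
      Finset.sum_mul]
    rw [Finset.sum_comm (s := grassmannian F V (k + 1))]
    refine Finset.sum_congr rfl fun A _ => ?_
    by_cases h : B ≤ A <;> simp [h]
  have h2 : sumBelow k (sumAbove (k + 1) g) B = ∑ B' ∈ grassmannian F V (k + 1),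
      (((grassmannian F V k).filter fun C => C ≤ B ∧ C ≤ B').card : ℝ) * g B' := by
    simp only [sumAbove, sumBelow, Finset.sum_filter, Finset.card_filter, Nat.cast_sum,
      Finset.sum_mul]
    rw [Finset.sum_comm (s := grassmannian F V (k + 1))]
    refine Finset.sum_congr rfl fun C _ => ?_
    by_cases h : C ≤ B <;> simp [h]
  have hB' : B ∈ grassmannian F V (k + 1) := mem_grassmannian.2 hB
  rw [h1, h2, ← Finset.add_sum_erase _ _ hB', ← Finset.add_sum_erase _ _ hB']
  simp only [and_self]
  rw [← card_filter_above hB, ← card_filter_below hB, Finset.sum_congr rfl fun B' hB' => by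
    rw [card_common_covers_eq hB (mem_grassmannian.1 (Finset.mem_of_mem_erase hB'))
      (Finset.ne_of_mem_erase hB')]]
  ring

/-- On functions of mean zero, the squared norm of the inclusion matrix between dimensions `k + 1`
and `k` is at most `q [k] [n - k - 1]`, its second largest squared singular value. The bounds for
consecutive `k` differ by the constant of the commutation relation `sumAbove_sumBelow`. -/
theorem sum_sumAbove_sq_le {k : ℕ} (hk : k + 1 ≤ finrank F V) (f : Submodule F V → ℝ)
    (hf : ∑ A ∈ grassmannian F V (k + 1), f A = 0) :
    ∑ B ∈ grassmannian F V k, sumAbove (k + 1) f B ^ 2 ≤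
      Nat.card F * qNumber (Nat.card F) k *
        qNumber (Nat.card F) ((finrank F V - (k + 1) : ℕ) : ℝ) *
        ∑ A ∈ grassmannian F V (k + 1), f A ^ 2 := by
  have hq : (1 : ℝ) < Nat.card F := by exact_mod_cast Finite.one_lt_card
  induction k generalizing f with
  | zero =>
    rw [Nat.cast_zero, qNumber_zero, mul_zero, zero_mul, zero_mul]
    refine (Finset.sum_eq_zero fun B hB => ?_).le
    rw [mem_grassmannian, Submodule.finrank_eq_zero] at hB
    subst hB
    simpa [sumAbove] using hf
  | succ k ih =>
    set g := sumAbove (k + 2) f with hg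
    have hgm : ∑ B ∈ grassmannian F V (k + 1), g B = 0 := by
      rw [hg, sum_sumAbove, hf, mul_zero]
    set μ := (Nat.card F : ℝ) * qNumber (Nat.card F) ((k + 1 : ℕ) : ℝ) *
        qNumber (Nat.card F) ((finrank F V - (k + 1 + 1) : ℕ) : ℝ) with hμ
    have hμ0 : 0 ≤ μ := mul_nonneg (mul_nonneg (by positivity) (qNumber_nonneg hq (by positivity)))
      (qNumber_nonneg hq (by positivity))
    -- `‖U g‖ ^ 2 = ⟪g, D U g⟫ = ‖D g‖ ^ 2 + c ‖g‖ ^ 2`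
    have hU : ∑ A ∈ grassmannian F V (k + 2), sumBelow (k + 1) g A ^ 2 ≤
        μ * ∑ B ∈ grassmannian F V (k + 1), g B ^ 2 := by
      have h1 := sum_mul_sumAbove (k + 1) (k + 2) (sumBelow (k + 1) g) g
      have h2 := sum_mul_sumAbove k (k + 1) g (sumAbove (k + 1) g)
      have h3 := ih (by omega) g hgm
      rw [Finset.sum_congr rfl fun B hB => by
        rw [sumAbove_sumBelow g (mem_grassmannian.1 hB)]] at h1
      simp only [mul_add, Finset.sum_add_distrib] at h1
      simp only [sq] at h3 ⊢
      have e1 := qNumber_add_one hq k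
      have e2 := qNumber_add_one hq ((finrank F V - (k + 2) : ℕ) : ℝ)
      rw [← Nat.cast_succ] at e1 e2
      rw [show (finrank F V - (k + 2)).succ = finrank F V - (k + 1) by omega] at e2
      rw [Finset.sum_congr rfl fun B _ => mul_left_comm (g B) _ _, ← Finset.mul_sum, e1, e2] at h1
      rw [e2] at h3
      rw [hμ, e1]
      rw [← h1, Finset.sum_congr rfl fun B _ => mul_comm (g B) (sumBelow _ _ _), ← h2]
      linear_combination h3
    -- `‖D f‖ ^ 2 = ⟪f, U g⟫ ≤ ‖f‖ ‖U g‖`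
    have hD : ∑ B ∈ grassmannian F V (k + 1), g B ^ 2 =
        ∑ A ∈ grassmannian F V (k + 2), sumBelow (k + 1) g A * f A := by
      rw [← sum_mul_sumAbove]
      simp only [sq, hg]
    have hCS := Finset.sum_mul_sq_le_sq_mul_sq (grassmannian F V (k + 2)) (sumBelow (k + 1) g) f
    rw [← hD] at hCS
    have hf0 : 0 ≤ ∑ A ∈ grassmannian F V (k + 2), f A ^ 2 :=
      Finset.sum_nonneg fun _ _ => sq_nonneg _
    have hg0 : 0 ≤ ∑ B ∈ grassmannian F V (k + 1), g B ^ 2 :=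
      Finset.sum_nonneg fun _ _ => sq_nonneg _
    rcases hg0.eq_or_lt with h | h
    · rw [← h]
      positivity
    · refine le_of_mul_le_mul_left ?_ h
      rw [← sq]
      refine hCS.trans ((mul_le_mul_of_nonneg_right hU hf0).trans_eq ?_)
      ring

end Spectral

/-! ### The number of `k`-dimensional subspaces -/
section Shadows

open Module

variable {F : Type*} [Field F] [Finite F] {V : Type*} [AddCommGroup V] [Module F V]
  [FiniteDimensional F V]

section

variable [Fintype (Submodule F V)]

/-- Double counting of the incidences between dimensions `k` and `k + 1`. -/
lemma card_grassmannian_succ (k : ℕ) :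
    ((grassmannian F V (k + 1)).card : ℝ) * qNumber (Nat.card F) ((k + 1 : ℕ) : ℝ) =
      (grassmannian F V k).card * qNumber (Nat.card F) ((finrank F V - k : ℕ) : ℝ) := by
  have h := sum_sumAbove (F := F) (V := V) k 1
  simp only [Pi.one_apply, Finset.sum_const, nsmul_eq_mul, mul_one] at h
  rw [mul_comm, ← h, ← nsmul_eq_mul, ← Finset.sum_const]
  refine Finset.sum_congr rfl fun B hB => ?_
  rw [← card_filter_above (mem_grassmannian.1 hB)]
  simp [sumAbove]

lemma card_grassmannian {k : ℕ} (hk : k ≤ finrank F V) :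
    ((grassmannian F V k).card : ℝ) = qBinom (Nat.card F) (finrank F V) k := by
  have hq : (1 : ℝ) < Nat.card F := by exact_mod_cast Finite.one_lt_card
  induction k with
  | zero =>
    rw [qBinom_zero_right, show grassmannian F V 0 = {⊥} by
      ext A
      rw [mem_grassmannian, Submodule.finrank_eq_zero, Finset.mem_singleton]]
    simp
  | succ k ih =>
    have h := card_grassmannian_succ (F := F) (V := V) k
    rw [qBinom_succ, mul_div_assoc', eq_div_iff (qNumber_pos hq (by positivity)).ne', h,
      ih (by omega), Nat.cast_sub (by omega)]

/-! ### Cross-independent pairs and shadows -/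

/-- Haemers' bound for a pair `S`, `T` without incidences between them, obtained by testing the
inclusion matrix on the centred indicator functions of `S` and `T`. -/
theorem card_mul_card_le_of_no_incidence {k : ℕ} (hk : k + 1 ≤ finrank F V)
    {S T : Finset (Submodule F V)} (hS : S ⊆ grassmannian F V (k + 1))
    (hT : T ⊆ grassmannian F V k) (hST : ∀ A ∈ S, ∀ B ∈ T, ¬ B ≤ A) :
    (S.card : ℝ) * T.card * (qNumber (Nat.card F) ((k + 1 : ℕ) : ℝ) *
        qNumber (Nat.card F) ((finrank F V - k : ℕ) : ℝ)) ≤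
      Nat.card F * qNumber (Nat.card F) k *
        qNumber (Nat.card F) ((finrank F V - (k + 1) : ℕ) : ℝ) *
        (((grassmannian F V (k + 1)).card - S.card) * ((grassmannian F V k).card - T.card)) := by
  classical
  have hq : (1 : ℝ) < Nat.card F := by exact_mod_cast Finite.one_lt_card
  have hN := card_grassmannian_succ (F := F) (V := V) k
  have hs : (S.card : ℝ) ≤ (grassmannian F V (k + 1)).card := by
    exact_mod_cast Finset.card_le_card hS
  have ht : (T.card : ℝ) ≤ (grassmannian F V k).card := by exact_mod_cast Finset.card_le_card hT
  have hspec := sum_sumAbove_sq_le (F := F) (V := V) hk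
  have hmean := sum_sumAbove (F := F) (V := V) k
  have p1 : 0 < qNumber (Nat.card F) ((k + 1 : ℕ) : ℝ) := qNumber_pos hq (by positivity)
  have p2 : 0 < qNumber (Nat.card F) ((finrank F V - k : ℕ) : ℝ) :=
    qNumber_pos hq (by exact_mod_cast Nat.sub_pos_of_lt hk)
  have hμ : 0 ≤ (Nat.card F : ℝ) * qNumber (Nat.card F) k *
      qNumber (Nat.card F) ((finrank F V - (k + 1) : ℕ) : ℝ) :=
    mul_nonneg (mul_nonneg (by positivity) (qNumber_nonneg hq (by positivity)))
      (qNumber_nonneg hq (by positivity))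
  set μ := (Nat.card F : ℝ) * qNumber (Nat.card F) k *
      qNumber (Nat.card F) ((finrank F V - (k + 1) : ℕ) : ℝ)
  set a := qNumber (Nat.card F) ((k + 1 : ℕ) : ℝ)
  set b := qNumber (Nat.card F) ((finrank F V - k : ℕ) : ℝ) with hb
  set N : ℝ := ((grassmannian F V (k + 1)).card : ℝ) with hNd
  set M : ℝ := ((grassmannian F V k).card : ℝ) with hMd
  set s : ℝ := (S.card : ℝ) with hsd
  set t : ℝ := (T.card : ℝ) with htd
  rcases (show 0 ≤ s * t by positivity).eq_or_lt with h0 | hst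
  · rw [← h0, zero_mul]
    exact mul_nonneg hμ (mul_nonneg (by linarith) (by linarith))
  have hs0 : 0 < s := pos_of_mul_pos_left hst (by positivity)
  have ht0 : 0 < t := pos_of_mul_pos_right hst (by positivity)
  have hN0 : 0 < N := by linarith
  have hM0 : 0 < M := by linarith
  -- the sums of an indicator function and of its centred square
  have hind : ∀ {U X : Finset (Submodule F V)}, U ⊆ X →
      ∑ A ∈ X, (if A ∈ U then (1 : ℝ) else 0) = U.card := by
    intro U X h
    rw [Finset.sum_ite_mem, Finset.inter_eq_right.2 h]
    simp
  have hsq : ∀ {U X : Finset (Submodule F V)}, U ⊆ X →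
      ∑ A ∈ X, ((X.card : ℝ) * (if A ∈ U then (1 : ℝ) else 0) - U.card) ^ 2 =
        X.card * U.card * (X.card - U.card) := by
    intro U X h
    have e : ∀ A, ((X.card : ℝ) * (if A ∈ U then (1 : ℝ) else 0) - U.card) ^ 2 =
        ((X.card : ℝ) ^ 2 - 2 * X.card * U.card) * (if A ∈ U then (1 : ℝ) else 0) +
          (U.card : ℝ) ^ 2 := by
      intro A
      split_ifs <;> ring
    rw [Finset.sum_congr rfl fun A _ => e A, Finset.sum_add_distrib, ← Finset.mul_sum, hind h]
    simp only [Finset.sum_const, nsmul_eq_mul]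
    ring
  set f : Submodule F V → ℝ := fun A => N * (if A ∈ S then 1 else 0) - s with hf
  set h : Submodule F V → ℝ := fun B => M * (if B ∈ T then 1 else 0) - t with hh
  have hf0 : ∑ A ∈ grassmannian F V (k + 1), f A = 0 := by
    rw [hf, Finset.sum_sub_distrib, ← Finset.mul_sum, hind hS]
    simp only [Finset.sum_const, nsmul_eq_mul]
    ring
  have hinner : ∑ B ∈ grassmannian F V k, h B * sumAbove (k + 1) f B = - (M * t * s * b) := by
    have e : ∀ B ∈ T, sumAbove (k + 1) f B = - (s * b) := by
      intro B hB
      rw [hb, ← card_filter_above (mem_grassmannian.1 (hT hB)), mul_comm, ← nsmul_eq_mul,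
        ← smul_neg, ← Finset.sum_const]
      refine Finset.sum_congr rfl fun A hA => ?_
      have : A ∉ S := fun hAS => hST A hAS B hB (Finset.mem_filter.1 hA).2
      simp [hf, this]
    simp only [hh, sub_mul, Finset.sum_sub_distrib, mul_assoc]
    rw [← Finset.mul_sum, ← Finset.mul_sum, hmean, hf0, mul_zero, mul_zero, sub_zero]
    simp only [ite_mul, one_mul, zero_mul]
    rw [Finset.sum_ite_mem, Finset.inter_eq_right.2 hT, Finset.sum_congr rfl e]
    simp only [Finset.sum_const, nsmul_eq_mul]
    ring
  have hCS := Finset.sum_mul_sq_le_sq_mul_sq (grassmannian F V k) h (sumAbove (k + 1) f)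
  have h1 : ∑ B ∈ grassmannian F V k, h B ^ 2 = M * t * (M - t) := hsq hT
  have h2 : ∑ A ∈ grassmannian F V (k + 1), f A ^ 2 = N * s * (N - s) := hsq hS
  have h3 := hspec f hf0
  rw [hinner, h1] at hCS
  rw [h2] at h3
  have h4 : 0 ≤ M * t * (M - t) := mul_nonneg (by positivity) (by linarith)
  have h5 := hCS.trans (mul_le_mul_of_nonneg_left h3 h4)
  have hc : 0 < M * t * s * M * b := by positivity
  refine le_of_mul_le_mul_left ?_ hc
  calc M * t * s * M * b * (s * t * (a * b)) = a * (-(M * t * s * b)) ^ 2 := by ring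
    _ ≤ a * (M * t * (M - t) * (μ * (N * s * (N - s)))) := by gcongr
    _ = (N * a) * (M * t * s * (μ * ((N - s) * (M - t)))) := by ring
    _ = _ := by rw [hN]; ring

end

/-- If the family `D` of `k`-dimensional subspaces contains all the hyperplanes of the members of
`S`, then `S` is a family of cliques over `D` and `card_le_qBinom_succ` bounds `D` from below. -/
theorem qBinom_le_card_of_shadow_subset {k : ℕ} {S D : Finset (Submodule F V)} (hne : S.Nonempty)
    (hS : ∀ A ∈ S, finrank F A = k + 1) (hDk : ∀ B ∈ D, finrank F B = k)
    (hD : ∀ A ∈ S, ∀ B ≤ A, finrank F B = k → B ∈ D) {x : ℝ} (hx : (k : ℝ) + 1 ≤ x)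
    (hc : (S.card : ℝ) = qBinom (Nat.card F) x (k + 1)) :
    qBinom (Nat.card F) x k ≤ D.card := by
  have hq : (1 : ℝ) < Nat.card F := by exact_mod_cast Finite.one_lt_card
  have hDne : D.Nonempty := by
    obtain ⟨A, hA⟩ := hne
    have h := natCard_coatoms (bot_le : ⊥ ≤ A)
    rw [hS A hA, finrank_bot, Nat.sub_zero, Finset.sum_range_succ] at h
    have h2 : 0 < Nat.card F ^ k := pow_pos Nat.card_pos k
    obtain ⟨⟨B, -, hBA, hB⟩⟩ := (Nat.card_pos_iff.1 (h ▸ Nat.add_pos_right _ h2)).1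
    exact ⟨B, hD A hA B hBA (by omega)⟩
  have h1 : (1 : ℝ) ≤ D.card := by exact_mod_cast hDne.card_pos
  rcases k with _ | k
  · rwa [qBinom_zero_right]
  by_contra! hlt
  obtain ⟨y, hy, hyc⟩ := exists_qBinom_eq hq k h1
  push_cast at hx hy
  have hyx : y < x := by
    by_contra! hle
    rcases hle.eq_or_lt with rfl | hle
    · linarith
    · have := qBinom_strictMono hq k (by linarith) hle
      linarith
  have h2 := card_le_qBinom_succ k (⊥ : Submodule F V) D S
    (fun B hB => ⟨bot_le, by rw [hDk B hB, finrank_bot]; omega⟩)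
    (fun A hA => ⟨bot_le, by rw [hS A hA, finrank_bot]; omega, fun B _ hBA hB =>
      hD A hA B hBA (by rw [hB, finrank_bot]; omega)⟩) hy hyc.symm
  have h3 := qBinom_strictMono hq (k + 1) (by push_cast; linarith) hyx
  linarith

/-- The members of `D` are given by their complement `T`. By duality, the annihilators of the
members of `T` are cliques over the annihilators of the subspaces outside `S`. -/
theorem card_le_qBinom_of_no_incidence {k j : ℕ} (hn : finrank F V = k + 1 + (j + 1))
    {Sc T : Finset (Submodule F V)} (hSc : ∀ A ∈ Sc, finrank F A = k + 1)
    (hT : ∀ B ∈ T, finrank F B = k)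
    (hST : ∀ B ∈ T, ∀ A, B ≤ A → finrank F A = k + 1 → A ∈ Sc) {y : ℝ} (hy : (j : ℝ) + 1 ≤ y)
    (hc : (Sc.card : ℝ) = qBinom (Nat.card F) y (j + 1)) :
    (T.card : ℝ) ≤ qBinom (Nat.card F) y (j + 2) := by
  classical
  have hinj : Function.Injective (Submodule.dualAnnihilator (R := F) (M := V)) :=
    fun A B h => Subspace.dualAnnihilator_inj.1 h
  have hd : ∀ A : Submodule F V, finrank F A + finrank F A.dualAnnihilator = finrank F V :=
    Subspace.finrank_add_finrank_dualAnnihilator_eq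
  rw [← Finset.card_image_of_injective T hinj]
  rw [← Finset.card_image_of_injective Sc hinj] at hc
  refine card_le_qBinom_succ j ⊥ (Sc.image Submodule.dualAnnihilator) _ ?_ ?_ hy hc
  · intro A' hA'
    obtain ⟨A, hA, rfl⟩ := Finset.mem_image.1 hA'
    have := hd A
    rw [hSc A hA] at this
    exact ⟨bot_le, by rw [finrank_bot]; omega⟩
  · intro C hC
    obtain ⟨B, hB, rfl⟩ := Finset.mem_image.1 hC
    have := hd B
    rw [hT B hB] at this
    refine ⟨bot_le, by rw [finrank_bot]; omega, fun A' _ hA'B hA' => ?_⟩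
    obtain ⟨A, rfl⟩ : ∃ A : Submodule F V, A.dualAnnihilator = A' :=
      ⟨_, Subspace.dualCoannihilator_dualAnnihilator_eq⟩
    have := hd A
    rw [finrank_bot] at hA'
    exact Finset.mem_image_of_mem _
      (hST B hB A (Subspace.dualAnnihilator_le_dualAnnihilator_iff.1 hA'B) (by omega))

end Shadows

theorem mainTheorem3 {F : Type*} [Field F] [Fintype F] (q : ℕ) (hq : Fintype.card F = q)
    (n k : ℕ) (hk : 1 ≤ k) (hkn : k ≤ n)
    (S : Set (Submodule F (Fin n → F))) (hS : ∅ ⊂ S) (hSL : S ⊂ subspacesOfDim F n k) :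
    (∀ x : ℝ, (k : ℝ) ≤ x → x ≤ (n : ℝ) - 1 →
      (S.ncard : ℝ) = qBinom q x k →
      ((shadow k S).ncard : ℝ) ≥ qBinom q x (k - 1)) ∧
    (∀ z : ℝ, 1 ≤ z → z ≤ (q : ℝ) ^ n →
      (S.ncard : ℝ) =
        qBinom q n k *
          (1 + z * ((q : ℝ) ^ k - 1) / ((q : ℝ) ^ k * ((q : ℝ) ^ (n - k) - 1)))⁻¹ →
      ((shadow k S).ncard : ℝ) ≥
        qBinom q n (k - 1) *
          (1 + z * ((q : ℝ) ^ (k - 1) - 1) /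
            ((q : ℝ) ^ (k - 1) * ((q : ℝ) ^ (n - k + 1) - 1)))⁻¹) ∧
    (∀ y : ℝ, (n : ℝ) - (k : ℝ) + 1 ≤ y → y ≤ (n : ℝ) - 1 →
      (S.ncard : ℝ) = qBinom q n k - qBinom q y (n - k) →
      ((shadow k S).ncard : ℝ) ≥ qBinom q n (k - 1) - qBinom q y (n - k + 1)) := by
  classical
  have := finite_submodule_of_finite (F := F) (V := Fin n → F)
  have := Fintype.ofFinite (Submodule F (Fin n → F))
  have hn : Module.finrank F (Fin n → F) = n := Module.finrank_fin_fun F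
  -- for `k = n` the whole space is the only candidate, so no proper nonempty `S` exists
  have hlt : k < n := by
    refine hkn.lt_of_ne fun hkn => ?_
    have htop : ∀ A ∈ subspacesOfDim F n k, A = ⊤ := fun A hA =>
      Submodule.eq_top_of_finrank_eq (by rw [hn]; exact Eq.trans hA hkn)
    obtain ⟨A, hA⟩ := Set.nonempty_iff_ne_empty.2 hS.ne'
    refine hSL.2 fun B hB => ?_
    rw [htop B hB, ← htop A (hSL.1 hA)]
    exact hA
  obtain ⟨k, rfl⟩ := Nat.exists_eq_add_of_le' hk
  obtain ⟨m, rfl⟩ := Nat.exists_eq_add_of_lt hlt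
  rw [← Nat.card_eq_fintype_card] at hq
  subst hq
  have hq : (1 : ℝ) < Nat.card F := by exact_mod_cast Finite.one_lt_card
  rw [Nat.add_sub_cancel, show k + 1 + m + 1 - (k + 1) = m + 1 by omega]
  rw [Set.ncard_eq_toFinset_card', Set.ncard_eq_toFinset_card']
  set S' := S.toFinset
  set D := (shadow (k + 1) S).toFinset
  have hSk : ∀ A ∈ S', Module.finrank F A = k + 1 := fun A hA => hSL.1 (Set.mem_toFinset.1 hA)
  have hDk : ∀ B ∈ D, Module.finrank F B = k := fun B hB => (Set.mem_toFinset.1 hB).1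
  have hD : ∀ A ∈ S', ∀ B ≤ A, Module.finrank F B = k → B ∈ D := by
    intro A hA B hBA hB
    refine Set.mem_toFinset.2 ⟨hB, A, Set.mem_toFinset.1 hA, hBA.lt_of_ne ?_⟩
    rintro rfl
    have := hSk B hA
    omega
  have hne : S'.Nonempty := Set.toFinset_nonempty.2 (Set.nonempty_iff_ne_empty.2 hS.ne')
  have hSsub : S' ⊆ grassmannian F (Fin (k + 1 + m + 1) → F) (k + 1) :=
    fun A hA => mem_grassmannian.2 (hSk A hA)
  have hDsub : D ⊆ grassmannian F (Fin (k + 1 + m + 1) → F) k :=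
    fun A hA => mem_grassmannian.2 (hDk A hA)
  have hN := card_grassmannian (F := F) (V := Fin (k + 1 + m + 1) → F) (k := k + 1) (by omega)
  have hM := card_grassmannian (F := F) (V := Fin (k + 1 + m + 1) → F) (k := k) (by omega)
  rw [hn] at hN hM
  -- the family `T` of all `k`-dimensional subspaces outside the shadow
  set T := grassmannian F (Fin (k + 1 + m + 1) → F) k \ D with hT
  have hTcard : (T.card : ℝ) = (grassmannian F (Fin (k + 1 + m + 1) → F) k).card - D.card :=
    Finset.cast_card_sdiff hDsub
  have hST : ∀ A ∈ S', ∀ B ∈ T, ¬ B ≤ A := by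
    intro A hA B hB hBA
    obtain ⟨hB1, hB2⟩ := Finset.mem_sdiff.1 hB
    exact hB2 (hD A hA B hBA (mem_grassmannian.1 hB1))
  refine ⟨fun x hx _ hc => ?_, fun z hz _ hc => ?_, fun y hy _ hc => ?_⟩
  · exact qBinom_le_card_of_shadow_subset hne hSk hDk hD (by exact_mod_cast hx) hc
  · have h := card_mul_card_le_of_no_incidence (by omega) hSsub Finset.sdiff_subset hST
    rw [hn, show k + 1 + m + 1 - k = m + 2 by omega,
      show k + 1 + m + 1 - (k + 1) = m + 1 by omega] at h
    simp only [qNumber_natCast] at h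
    rw [← hN] at hc
    rw [← hM]
    set Q : ℝ := (Nat.card F : ℝ)
    set N : ℝ := ((grassmannian F (Fin (k + 1 + m + 1) → F) (k + 1)).card : ℝ)
    set M : ℝ := ((grassmannian F (Fin (k + 1 + m + 1) → F) k).card : ℝ)
    have hs : (0 : ℝ) < S'.card := by exact_mod_cast hne.card_pos
    have hQ : 0 < Q - 1 := by linarith
    have hk0 : 0 ≤ Q ^ k - 1 := by linarith [one_le_pow₀ (n := k) hq.le]
    have hk1 : 0 < Q ^ (k + 1) - 1 := sub_pos.2 (one_lt_pow₀ hq k.succ_ne_zero)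
    have hm1 : 0 < Q ^ (m + 1) - 1 := sub_pos.2 (one_lt_pow₀ hq m.succ_ne_zero)
    have hm2 : 0 < Q ^ (m + 1 + 1) - 1 := sub_pos.2 (one_lt_pow₀ hq (m + 1).succ_ne_zero)
    have hQk : 0 < Q ^ k := by positivity
    have ha : 0 < 1 + z * (Q ^ (k + 1) - 1) / (Q ^ (k + 1) * (Q ^ (m + 1) - 1)) := by positivity
    have hb : 0 < 1 + z * (Q ^ k - 1) / (Q ^ k * (Q ^ (m + 1 + 1) - 1)) := by positivity
    rw [← div_eq_mul_inv, eq_div_iff ha.ne'] at hc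
    rw [ge_iff_le, ← div_eq_mul_inv, div_le_iff₀ hb]
    rw [hTcard, ← hc] at h
    -- cancelling the common factors of Haemers' bound
    have h' : (M - D.card) * (Q ^ k * (Q ^ (m + 1 + 1) - 1)) ≤ z * (Q ^ k - 1) * D.card := by
      have hpos : 0 < S'.card * (Q ^ (k + 1) - 1) / ((Q - 1) ^ 2 * Q ^ k) := by positivity
      refine le_of_mul_le_mul_left (le_of_eq_of_le ?_ (h.trans_eq ?_)) hpos
      · field_simp
      · field_simp
        ring
    rw [← le_div_iff₀ (by positivity)] at h'
    linear_combination h'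
  · have hyn : (m : ℝ) + 1 ≤ y := by
      push_cast at hy
      linarith
    have hScard : (((grassmannian F (Fin (k + 1 + m + 1) → F) (k + 1)) \ S').card : ℝ) =
        qBinom (Nat.card F) y (m + 1) := by
      rw [Finset.cast_card_sdiff hSsub, hN, hc]
      ring
    have h := card_le_qBinom_of_no_incidence (T := T) (by rw [hn]; omega)
      (fun A hA => mem_grassmannian.1 (Finset.mem_sdiff.1 hA).1)
      (fun B hB => mem_grassmannian.1 (Finset.mem_sdiff.1 hB).1)
      (fun B hB A hBA hA => Finset.mem_sdiff.2
        ⟨mem_grassmannian.2 hA, fun hAS => hST A hAS B hB hBA⟩) hyn hScard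
    rw [hTcard, hM] at h
    linarith
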